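/- **Setting.** Let $d\ge 1$. A problem with two experts and $d$ tasks is a family $\nu=(\nu_{ij})_{i\in\{1,2\},\,1\le j\le d}$ of probability distributions on $\mathbb R$, each $1$-sub-Gaussian (if $X\sim\nu_{ij}$ then $\mathbb E\,e^{s(X-\mathbb EX)}\le e^{s^2/2}$ for all $s\in\mathbb R$), with mean matrix $M=M(\nu)\in\mathbb R^{2\times d}$; write $M_i$ for its $i$-th row. A permutation $\pi$ of $\{1,2\}$ ranks $M$ if $M_{\pi(1),j}\ge M_{\pi(2),j}$ for all $j$. Let $\mathcal M_{2,d}$ be the set of matrices $M\in[0,1]^{2\times d}$ that are ranked by some permutation and satisfy $M_1\ne M_2$ (so that the ranking $\pi$ is unique). A (possibly randomized) algorithm sequentially chooses an expert-task pair $(I_t,J_t)$ as a function of its internal randomness and of its past observations, receives an independent sample from $\nu_{I_tJ_t}$, and decides in the same way when to terminate and what to output; $N\in\mathbb N\cup\{\infty\}$ is the number of queries it makes. It outputs either a ranking $\hat\pi$ or an expert $\hat k$. It is $\delta$-accurate for ranking identification (respectively, for best-expert identification) if on every $1$-sub-Gaussian problem with mean matrix in $\mathcal M_{2,d}$ and ranking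 $\pi$, the probability that it terminates with $\hat\pi\ne\pi$ (respectively, with $\hat k\neq\pi(1)$) is at most $\delta$. **Theorem.** Let $d\ge1$, $\delta\in(0,1/4)$ and $M_0\in\mathcal M_{2,d}$, with ranking $\pi_0$ and gap vector $\underline\Delta=\big(|(M_0)_{1,j}-(M_0)_{2,j}|\big)_{1\le j\le d}$. Let $A$ be an algorithm that is $\delta$-accurate for ranking identification, or one that is $\delta$-accurate for best-expert identification. Put $$x=\frac{d}{2\,\|(M_0)_{1}-(M_0)_{2}\|_2^2}\,\log\Big(\frac1{6\delta}\Big).$$ 1. There is a $1$-sub-Gaussian problem $\nu$ with $\mathbb P_{\nu,A}[N\ge x]\ge\delta$ whose mean matrix $M$ has a ranking $\pi$ such that $M_{\pi(2),j}=(M_0)_{\pi_0(2),j}$ and $M_{\pi(1),j}=(M_0)_{\pi_0(2),j}+\underline\Delta_{\sigma(j)}$ for all $j$, for some permutation $\sigma$ of $\{1,\dots,d\}$. (The entries of $M_{\pi(1)}$ are not required to be at most $1$.) 2. There is a $1$-sub-Gaussian problem $\nu$ with $\mathbb P_{\nu,A}[N\ge x]\ge\delta$ whose mean matrix $M$ lies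 in $\mathcal M_{2,d}$, in particular has entries in $[0,1]$, and satisfies $|M_{1,j}-M_{2,j}|=\underline\Delta_{\sigma(j)}$ for all $j$, for some permutation $\sigma$ of $\{1,\dots,d\}$. -/

import Mathlib

open MeasureTheory ProbabilityTheory
open scoped ENNReal

noncomputable section

/-- `π` ranks the experts of the mean matrix `M` from best to worst: on every task the mean
performance is nonincreasing along `π 0, π 1, …`. -/
def IsRanking {n d : ℕ} (M : Matrix (Fin n) (Fin d) ℝ) (π : Equiv.Perm (Fin n)) : Prop :=
  ∀ j, Antitone fun i => M (π i) j

/-- Mean matrices that are monotone up to a permutation of the experts and have entries in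
`[0,1]`. -/
def IsMonotoneBounded {n d : ℕ} (M : Matrix (Fin n) (Fin d) ℝ) : Prop :=
  (∃ π, IsRanking M π) ∧ ∀ i j, M i j ∈ Set.Icc (0 : ℝ) 1

/-- Admissible mean matrices for ranking identification: any two experts differ on some task. -/
def rankingMatrices (n d : ℕ) : Set (Matrix (Fin n) (Fin d) ℝ) :=
  {M | IsMonotoneBounded M ∧ ∀ i k, i ≠ k → ∃ j, M i j ≠ M k j}

/-- Admissible mean matrices for best-expert identification: any other expert differs from the
top-ranked one on some task. -/
def bestExpertMatrices (n d : ℕ) [NeZero n] : Set (Matrix (Fin n) (Fin d) ℝ) :=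
  {M | IsMonotoneBounded M ∧
    ∀ π, IsRanking M π → ∀ i, i ≠ 0 → ∃ j, M (π i) j ≠ M (π 0) j}

/-- A performance distribution: one probability law on `ℝ` for every expert-task pair. -/
abbrev PerformanceDistribution (n d : ℕ) : Type :=
  Fin n → Fin d → ProbabilityMeasure ℝ

namespace PerformanceDistribution

variable {n d : ℕ}

/-- The matrix of means. -/
def mean (ν : PerformanceDistribution n d) : Matrix (Fin n) (Fin d) ℝ :=
  fun i j => ∫ z, z ∂(ν i j : Measure ℝ)

/-- Every entry is `1`-sub-Gaussian: `𝔼 exp (s (X - 𝔼 X)) ≤ exp (s ^ 2 / 2)` for all real `s`. -/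
def IsSubGaussian (ν : PerformanceDistribution n d) : Prop :=
  ∀ i j, HasSubgaussianMGF (fun z : ℝ => z - ν.mean i j) 1 (ν i j : Measure ℝ)

end PerformanceDistribution

/-- A (possibly randomized) sequential algorithm with outputs in `O`. It draws a seed once. After
`t` queries it looks at the seed and at the `t` samples received so far (the past queries are
functions of these), and either queries an expert-task pair (`Sum.inl`) or terminates with an
output (`Sum.inr`). -/
structure Algorithm (n d : ℕ) (O : Type) where
  Seed : Type*
  [measurableSpaceSeed : MeasurableSpace Seed]
  seedLaw : ProbabilityMeasure Seed
  decision : (t : ℕ) → Seed → (Fin t → ℝ) → (Fin n × Fin d) ⊕ O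
  measurableSet_decision : ∀ (t : ℕ) (a : (Fin n × Fin d) ⊕ O),
    MeasurableSet {p : Seed × (Fin t → ℝ) | decision t p.1 p.2 = a}

attribute [instance] Algorithm.measurableSpaceSeed

namespace Algorithm

variable {n d : ℕ} {O : Type}

/-- A realization of all the randomness: the seed of the algorithm and, for each time `t`, a table
`x t` whose entry `(i, j)` is the sample that a query of `(i, j)` at time `t` returns. -/
abbrev Outcome (A : Algorithm n d O) : Type _ :=
  A.Seed × (ℕ → Fin n × Fin d → ℝ)

/-- The samples received in the first `t` queries (padded with `0` after termination). -/
def samples (A : Algorithm n d O) (ω : A.Outcome) : (t : ℕ) → (Fin t → ℝ)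
  | 0 => Fin.elim0
  | t + 1 => Fin.snoc (α := fun _ => ℝ) (A.samples ω t)
      (Sum.elim (fun q => ω.2 t q) (fun _ => 0) (A.decision t ω.1 (A.samples ω t)))

/-- The decision taken after `t` queries. -/
def decisionAt (A : Algorithm n d O) (ω : A.Outcome) (t : ℕ) : (Fin n × Fin d) ⊕ O :=
  A.decision t ω.1 (A.samples ω t)

/-- The total number of queries `N`; it is `⊤` if the algorithm never terminates. -/
def numQueries (A : Algorithm n d O) (ω : A.Outcome) : ℕ∞ :=
  ⨅ (t : ℕ) (_ : (A.decisionAt ω t).isRight), (t : ℕ∞)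

/-- The algorithm terminates, and its output is `o`. -/
def Outputs (A : Algorithm n d O) (ω : A.Outcome) (o : O) : Prop :=
  ∃ t : ℕ, A.numQueries ω = t ∧ A.decisionAt ω t = Sum.inr o

/-- The law of all the randomness on the problem `ν`: the seed and all entries of all tables are
independent, and the entries at position `(i, j)` have law `ν i j`. -/
def law (A : Algorithm n d O) (ν : PerformanceDistribution n d) : Measure A.Outcome :=
  (A.seedLaw : Measure A.Seed).prod
    (Measure.infinitePi fun _ : ℕ =>
      Measure.pi fun q : Fin n × Fin d => (ν q.1 q.2 : Measure ℝ))

/-- The probability, on the problem `ν`, that `N ≥ x`. -/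
def probQueriesGE (A : Algorithm n d O) (ν : PerformanceDistribution n d) (x : ℝ) : ℝ :=
  (A.law ν).real {ω | ENNReal.ofReal x ≤ (A.numQueries ω : ℝ≥0∞)}

/-- `δ`-accuracy for ranking identification: on every sub-Gaussian problem with an admissible mean
matrix, a wrong ranking is output with probability at most `δ`. -/
def IsAccurateForRanking (A : Algorithm n d (Equiv.Perm (Fin n))) (δ : ℝ) : Prop :=
  ∀ ν : PerformanceDistribution n d, ν.IsSubGaussian → ν.mean ∈ rankingMatrices n d →
    ∀ π, IsRanking ν.mean π → (A.law ν).real {ω | ∃ o, A.Outputs ω o ∧ o ≠ π} ≤ δ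

/-- `δ`-accuracy for best-expert identification: on every sub-Gaussian problem with an admissible
mean matrix, a wrong expert is output with probability at most `δ`. -/
def IsAccurateForBestExpert [NeZero n] (A : Algorithm n d (Fin n)) (δ : ℝ) : Prop :=
  ∀ ν : PerformanceDistribution n d, ν.IsSubGaussian → ν.mean ∈ bestExpertMatrices n d →
    ∀ π, IsRanking ν.mean π → (A.law ν).real {ω | ∃ o, A.Outputs ω o ∧ o ≠ π 0} ≤ δ

end Algorithm

/-- The gap on each task between the two experts. -/
def gap {d : ℕ} (M : Matrix (Fin 2) (Fin d) ℝ) (j : Fin d) : ℝ :=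
  |M 0 j - M 1 j|

/-- Sub-Gaussian problems in which the mean row of the worst expert is the worst row of `M₀`, and
the mean row of the best expert is that row plus a permutation of the gaps of `M₀`. (The means of
the best expert are not required to be at most `1`.) -/
def sameWorstClass {d : ℕ} (M₀ : Matrix (Fin 2) (Fin d) ℝ) : Set (PerformanceDistribution 2 d) :=
  {ν | ν.IsSubGaussian ∧ ∃ π₀, IsRanking M₀ π₀ ∧ ∃ π, IsRanking ν.mean π ∧
    ∃ σ : Equiv.Perm (Fin d), ∀ j,
      ν.mean (π 1) j = M₀ (π₀ 1) j ∧ ν.mean (π 0) j = M₀ (π₀ 1) j + gap M₀ (σ j)}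

/-- Sub-Gaussian problems with an admissible mean matrix, with entries in `[0,1]`, whose gaps are
a permutation of those of `M₀`. -/
def boundedClass {d : ℕ} (M₀ : Matrix (Fin 2) (Fin d) ℝ) : Set (PerformanceDistribution 2 d) :=
  {ν | ν.IsSubGaussian ∧ ν.mean ∈ rankingMatrices 2 d ∧
    ∃ σ : Equiv.Perm (Fin d), ∀ j, gap ν.mean j = gap M₀ (σ j)}

/-- The lower bound on the number of queries. -/
def queryBound {d : ℕ} (M₀ : Matrix (Fin 2) (Fin d) ℝ) (δ : ℝ) : ℝ :=
  d / (2 * ‖WithLp.toLp 2 (M₀ 0 - M₀ 1)‖ ^ 2) * Real.log (1 / (6 * δ))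

end

/-! The reference is a Gaussian problem whose two experts share one mean row. It is a limit of
admissible problems with either ranking, and each output is wrong for one of the two. Fatou's lemma
then shows that stopping within `T` queries has probability at most `2δ` there
(`IsAccurateFor.law_compl_continues_le`). It remains to transfer the event "still running after `T`
queries" to a problem with the gaps of `M₀`.

The gaps are placed in `d` cyclic arrangements. For every expert-task pair the squared shift,
averaged over the arrangements, is at most `S`, the squared norm of the gap vector divided by `d`;
this is where the factor `d` comes from. Let `L k` be the likelihood ratio of the `k`-th arrangement
against the reference after `T` queries. By convexity of `exp`, the average over `k` of `𝔼 √(L k)`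
is at least the expectation of `exp` of the average of `log (L k) / 2`. Each query changes that
exponent by a centred Gaussian minus at most `S / 4`, whichever pair is chosen, so the expectation
is at least `exp (-(T * S / 4))` (`exp_le_average_sqrt_weight`). If every arrangement were still
running with probability below `δ`, splitting `𝔼 √(L k)` along this event would bound it by `√δ +
√(2δ)`, whose square is below `6δ`: a contradiction for `T < x` (`exists_le_law_gaussian_add`).

Accuracy is used only near the reference, so the hard instance itself need not be admissible. -/

namespace Algorithm

variable {n d : ℕ} {O : Type} (A : Algorithm n d O)

/-! ### Measurability and law of the history -/

instance (ν : PerformanceDistribution n d) : IsProbabilityMeasure (A.law ν) := by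
  unfold law; infer_instance

/-- The output type may be uncountable, so termination is handled as the complement of finitely many
query events. -/
lemma measurableSet_isRight (t : ℕ) :
    MeasurableSet {p : A.Seed × (Fin t → ℝ) | (A.decision t p.1 p.2).isRight} := by
  have h : {p : A.Seed × (Fin t → ℝ) | (A.decision t p.1 p.2).isRight} =
      (⋃ q : Fin n × Fin d, {p | A.decision t p.1 p.2 = Sum.inl q})ᶜ := by
    ext p
    cases h : A.decision t p.1 p.2 <;> simp [h]
  rw [h]
  exact (MeasurableSet.iUnion fun q => A.measurableSet_decision t _).compl

/-- A function defined by cases on the decision is measurable if every case is. -/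
lemma measurable_elim_decision {β : Type*} [MeasurableSpace β] (t : ℕ) {X : Type*}
    [MeasurableSpace X] {g : X → A.Seed × (Fin t → ℝ)} (hg : Measurable g)
    {f : Fin n × Fin d → X → β} (hf : ∀ q, Measurable (f q)) {f' : X → β} (hf' : Measurable f') :
    Measurable fun p => Sum.elim (fun q => f q p) (fun _ => f' p)
      (A.decision t (g p).1 (g p).2) := by
  intro s hs
  have h : (fun p => Sum.elim (fun q => f q p) (fun _ => f' p)
        (A.decision t (g p).1 (g p).2)) ⁻¹' s =
      (⋃ q : Fin n × Fin d, g ⁻¹' {p | A.decision t p.1 p.2 = Sum.inl q} ∩ f q ⁻¹' s) ∪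
        (g ⁻¹' {p | (A.decision t p.1 p.2).isRight} ∩ f' ⁻¹' s) := by
    ext p
    cases h : A.decision t (g p).1 (g p).2 <;> simp [h]
  rw [h]
  exact (MeasurableSet.iUnion fun q => (hg (A.measurableSet_decision t _)).inter (hf q hs)).union
    ((hg (A.measurableSet_isRight t)).inter (hf' hs))

lemma measurable_snoc {X : Type*} [MeasurableSpace X] {t : ℕ} {f : X → Fin t → ℝ} {g : X → ℝ}
    (hf : Measurable f) (hg : Measurable g) :
    Measurable fun p => (Fin.snoc (α := fun _ => ℝ) (f p) (g p) : Fin (t + 1) → ℝ) := by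
  refine measurable_pi_lambda _ fun i => ?_
  induction i using Fin.lastCases with
  | last => simpa using hg
  | cast i => simpa using measurable_pi_iff.1 hf i

lemma measurable_samples (t : ℕ) : Measurable fun ω : A.Outcome => A.samples ω t := by
  induction t with
  | zero => exact measurable_const
  | succ t ih =>
    refine measurable_snoc ih ?_
    exact A.measurable_elim_decision t (measurable_fst.prodMk ih)
      (fun q => (measurable_pi_apply q).comp ((measurable_pi_apply t).comp measurable_snd))
      measurable_const

lemma lintegral_law (ν : PerformanceDistribution n d) {f : A.Outcome → ℝ≥0∞}
    (hf : Measurable f) :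
    ∫⁻ ω, f ω ∂A.law ν = ∫⁻ s, ∫⁻ x, f (s, x) ∂(Measure.infinitePi fun _ : ℕ =>
      Measure.pi fun q : Fin n × Fin d => (ν q.1 q.2 : Measure ℝ)) ∂(A.seedLaw : Measure A.Seed) :=
  lintegral_prod f hf.aemeasurable

lemma samples_congr (s : A.Seed) {x x' : ℕ → Fin n × Fin d → ℝ} {t : ℕ}
    (h : ∀ i < t, x i = x' i) : A.samples (s, x) t = A.samples (s, x') t := by
  induction t with
  | zero => rfl
  | succ t ih =>
    simp only [samples, ih fun i hi => h i (by omega), h t (by omega)]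

/-- The samples of the first `t` queries are independent of the table at time `t`. -/
lemma indepFun_samples (ν : PerformanceDistribution n d) (s : A.Seed) (t : ℕ) :
    IndepFun (fun x : ℕ → Fin n × Fin d → ℝ => A.samples (s, x) t) (fun x => x t)
      (Measure.infinitePi fun _ : ℕ =>
        Measure.pi fun q : Fin n × Fin d => (ν q.1 q.2 : Measure ℝ)) := by
  have hI := iIndepFun_infinitePi (P := fun _ : ℕ =>
      Measure.pi fun q : Fin n × Fin d => (ν q.1 q.2 : Measure ℝ))
    (X := fun _ x => x) (fun _ => measurable_id)
  have h := hI.indepFun_finset (Finset.range t) {t} (by simp) (fun i => measurable_pi_apply i)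
  -- Tables from time `t` on do not affect the first `t` samples, so filling them with `0` exhibits
  -- the samples as a function of the earlier tables.
  let ext : (Finset.range t → Fin n × Fin d → ℝ) → ℕ → Fin n × Fin d → ℝ :=
    fun y i => if hi : i ∈ Finset.range t then y ⟨i, hi⟩ else 0
  have hext : Measurable ext := by
    refine measurable_pi_lambda _ fun i => ?_
    by_cases hi : i ∈ Finset.range t
    · simpa only [ext, hi, dif_pos] using measurable_pi_apply _
    · simpa only [ext, hi, dif_neg, not_false_eq_true] using measurable_const
  have hφ : Measurable fun y => A.samples (s, ext y) t :=
    (A.measurable_samples t).comp (measurable_const.prodMk hext)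
  have hψ : Measurable fun z : ({t} : Finset ℕ) → Fin n × Fin d → ℝ => z ⟨t, by simp⟩ :=
    measurable_pi_apply _
  have h' := h.comp hφ hψ
  convert h' using 1
  · funext x
    refine A.samples_congr s fun i hi => ?_
    simp [ext, hi]
  · rfl

/-- Disintegration of the history after `t + 1` queries over the history after `t` queries. -/
lemma lintegral_samples_succ (ν : PerformanceDistribution n d) (t : ℕ)
    {F : A.Seed × (Fin (t + 1) → ℝ) → ℝ≥0∞} (hF : Measurable F) :
    ∫⁻ ω, F (ω.1, A.samples ω (t + 1)) ∂A.law ν =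
      ∫⁻ ω, Sum.elim
        (fun q => ∫⁻ y, F (ω.1, Fin.snoc (α := fun _ => ℝ) (A.samples ω t) y)
          ∂(ν q.1 q.2 : Measure ℝ))
        (fun _ => F (ω.1, Fin.snoc (α := fun _ => ℝ) (A.samples ω t) 0))
        (A.decisionAt ω t) ∂A.law ν := by
  have hmeas : Measurable fun p : A.Seed × (Fin t → ℝ) => Sum.elim
        (fun q : Fin n × Fin d => ∫⁻ y, F (p.1, Fin.snoc (α := fun _ => ℝ) p.2 y)
          ∂(ν q.1 q.2 : Measure ℝ))
        (fun _ => F (p.1, Fin.snoc (α := fun _ => ℝ) p.2 0)) (A.decision t p.1 p.2) := by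
    refine A.measurable_elim_decision t measurable_id (fun q => ?_) ?_
    · refine Measurable.lintegral_prod_right'
        (f := fun z : (A.Seed × (Fin t → ℝ)) × ℝ =>
          F (z.1.1, Fin.snoc (α := fun _ => ℝ) z.1.2 z.2)) ?_
      exact hF.comp ((measurable_fst.comp measurable_fst).prodMk
        (measurable_snoc (measurable_snd.comp measurable_fst) measurable_snd))
    · exact hF.comp (measurable_fst.prodMk (measurable_snoc measurable_snd measurable_const))
  have hsamp := A.measurable_samples
  refine (A.lintegral_law ν (hF.comp (measurable_fst.prodMk (hsamp (t + 1))))).trans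
    (Eq.trans ?_ (A.lintegral_law ν (hmeas.comp (measurable_fst.prodMk (hsamp t)))).symm)
  refine lintegral_congr fun s => ?_
  set P := Measure.infinitePi fun _ : ℕ =>
        Measure.pi fun q : Fin n × Fin d => (ν q.1 q.2 : Measure ℝ) with hP
  have hs : Measurable fun x : ℕ → Fin n × Fin d → ℝ => A.samples (s, x) t :=
    (hsamp t).comp (measurable_const.prodMk measurable_id)
  have hmap := (indepFun_iff_map_prod_eq_prod_map_map hs.aemeasurable
    (measurable_pi_apply t).aemeasurable).1 (A.indepFun_samples ν s t)
  rw [← hP, (measurePreserving_eval_infinitePi _ t).map_eq] at hmap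
  let G : (Fin t → ℝ) × (Fin n × Fin d → ℝ) → ℝ≥0∞ := fun z =>
    F (s, Fin.snoc (α := fun _ => ℝ) z.1
      (Sum.elim (fun q => z.2 q) (fun _ => 0) (A.decision t s z.1)))
  have hG : Measurable G := by
    refine hF.comp (measurable_const.prodMk (measurable_snoc measurable_fst ?_))
    exact A.measurable_elim_decision t (measurable_const.prodMk measurable_fst)
      (fun q => (measurable_pi_apply q).comp measurable_snd) measurable_const
  change ∫⁻ x, G (A.samples (s, x) t, x t) ∂P = _
  rw [← lintegral_map (f := G) (g := fun x => (A.samples (s, x) t, x t)) hG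
    (hs.prodMk (measurable_pi_apply t)), hmap, lintegral_prod _ hG.aemeasurable,
    lintegral_map hG.lintegral_prod_right' hs]
  refine lintegral_congr fun x => ?_
  simp only [G, Function.comp_apply]
  cases h : A.decision t s (A.samples (s, x) t) with
  | inr o => simp
  | inl q =>
    simp only [Sum.elim_inl]
    have hF' : Measurable fun y : ℝ =>
        F (s, Fin.snoc (α := fun _ => ℝ) (A.samples (s, x) t) y) :=
      hF.comp (measurable_const.prodMk (measurable_snoc measurable_const measurable_id))
    -- Given the history, only the queried entry of the fresh table is seen, and its marginal is the
    -- law of that pair.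
    exact (measurePreserving_eval (fun q : Fin n × Fin d => (ν q.1 q.2 : Measure ℝ)) q
      ).lintegral_comp hF'

/-! ### Multiplicative weights along a history -/

/-- The sum of `ℓ (I, J) X` over the queries `(I, J)` and samples `X` of a history. -/
def logWeight (ℓ : Fin n × Fin d → ℝ → ℝ) : (t : ℕ) → A.Seed → (Fin t → ℝ) → ℝ
  | 0, _, _ => 0
  | t + 1, s, h => logWeight ℓ t s (Fin.init h) +
      Sum.elim (fun q => ℓ q (h (Fin.last t))) (fun _ => 0) (A.decision t s (Fin.init h))

variable {ℓ : Fin n × Fin d → ℝ → ℝ}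

lemma logWeight_snoc (t : ℕ) (s : A.Seed) (h : Fin t → ℝ) (y : ℝ) :
    A.logWeight ℓ (t + 1) s (Fin.snoc (α := fun _ => ℝ) h y) =
      A.logWeight ℓ t s h + Sum.elim (fun q => ℓ q y) (fun _ => 0) (A.decision t s h) := by
  simp [logWeight]

lemma measurable_logWeight (hℓ : ∀ q, Measurable (ℓ q)) (t : ℕ) :
    Measurable fun p : A.Seed × (Fin t → ℝ) => A.logWeight ℓ t p.1 p.2 := by
  induction t with
  | zero => exact measurable_const
  | succ t ih =>
    have hi : Measurable fun p : A.Seed × (Fin (t + 1) → ℝ) => (p.1, Fin.init p.2) :=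
      measurable_fst.prodMk (measurable_pi_lambda _ fun i =>
        (measurable_pi_apply i.castSucc).comp measurable_snd)
    exact (ih.comp hi).add (A.measurable_elim_decision t hi
      (fun q => (hℓ q).comp ((measurable_pi_apply _).comp measurable_snd)) measurable_const)

/-- Change of measure: `exp (logWeight ℓ)` is a likelihood ratio if each `exp (ℓ q)` is. -/
lemma lintegral_samples_eq_weight {ν ν' : PerformanceDistribution n d}
    (hℓ : ∀ q, Measurable (ℓ q))
    (hν : ∀ q : Fin n × Fin d, (ν' q.1 q.2 : Measure ℝ) =
      (ν q.1 q.2 : Measure ℝ).withDensity fun y => ENNReal.ofReal (Real.exp (ℓ q y)))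
    (t : ℕ) {F : A.Seed × (Fin t → ℝ) → ℝ≥0∞} (hF : Measurable F) :
    ∫⁻ ω, F (ω.1, A.samples ω t) ∂A.law ν' =
      ∫⁻ ω, ENNReal.ofReal (Real.exp (A.logWeight ℓ t ω.1 (A.samples ω t))) *
        F (ω.1, A.samples ω t) ∂A.law ν := by
  have hexp : Measurable fun y : ℝ => ENNReal.ofReal (Real.exp y) := by fun_prop
  induction t with
  | zero =>
    have h (ω : A.Outcome) : A.samples ω 0 = Fin.elim0 := rfl
    simp only [h, logWeight, Real.exp_zero, ENNReal.ofReal_one, one_mul]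
    have hF' : Measurable fun s => F (s, Fin.elim0) := hF.comp (measurable_id.prodMk measurable_const)
    refine (A.lintegral_law ν' (hF'.comp measurable_fst)).trans
      (Eq.trans ?_ (A.lintegral_law ν (hF'.comp measurable_fst)).symm)
    simp
  | succ t ih =>
    have hsn : Measurable fun z : (A.Seed × (Fin t → ℝ)) × ℝ =>
        (z.1.1, (Fin.snoc (α := fun _ => ℝ) z.1.2 z.2 : Fin (t + 1) → ℝ)) :=
      (measurable_fst.comp measurable_fst).prodMk
        (measurable_snoc (measurable_snd.comp measurable_fst) measurable_snd)
    have hG : Measurable fun p : A.Seed × (Fin t → ℝ) => Sum.elim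
        (fun q : Fin n × Fin d => ∫⁻ y, F (p.1, Fin.snoc (α := fun _ => ℝ) p.2 y)
          ∂(ν' q.1 q.2 : Measure ℝ))
        (fun _ => F (p.1, Fin.snoc (α := fun _ => ℝ) p.2 0)) (A.decision t p.1 p.2) := by
      refine A.measurable_elim_decision t measurable_id (fun q => ?_) ?_
      · exact Measurable.lintegral_prod_right' (hF.comp hsn)
      · exact (hF.comp hsn).comp (measurable_id.prodMk measurable_const)
    rw [A.lintegral_samples_succ ν' t hF, A.lintegral_samples_succ ν t
      (F := fun p => ENNReal.ofReal (Real.exp (A.logWeight ℓ (t + 1) p.1 p.2)) * F p)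
      ((hexp.comp (A.measurable_logWeight hℓ (t + 1))).mul hF)]
    refine (ih hG).trans (lintegral_congr fun ω => ?_)
    simp only [logWeight_snoc, decisionAt]
    cases h : A.decision t ω.1 (A.samples ω t) with
    | inr o => simp
    | inl q =>
      have hFy : Measurable fun y : ℝ =>
          F (ω.1, Fin.snoc (α := fun _ => ℝ) (A.samples ω t) y) :=
        (hF.comp hsn).comp ((measurable_const (a := (ω.1, A.samples ω t))).prodMk measurable_id)
      have hℓq : Measurable fun y => ENNReal.ofReal (Real.exp (ℓ q y)) := hexp.comp (hℓ q)
      simp only [Sum.elim_inl]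
      rw [hν q, lintegral_withDensity_eq_lintegral_mul _ hℓq hFy,
        ← lintegral_const_mul _ (hℓq.mul hFy)]
      refine lintegral_congr fun y => ?_
      simp only [Pi.mul_apply, Real.exp_add]
      rw [ENNReal.ofReal_mul (Real.exp_pos _).le, mul_assoc]

/-- If every factor has mean at least `ρ ≤ 1`, then the weight has mean at least `ρ ^ t`. -/
lemma pow_le_lintegral_weight {ν : PerformanceDistribution n d} (hℓ : ∀ q, Measurable (ℓ q))
    {ρ : ℝ≥0∞} (hρ : ρ ≤ 1)
    (h : ∀ q : Fin n × Fin d,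
      ρ ≤ ∫⁻ y, ENNReal.ofReal (Real.exp (ℓ q y)) ∂(ν q.1 q.2 : Measure ℝ)) (t : ℕ) :
    ρ ^ t ≤ ∫⁻ ω, ENNReal.ofReal (Real.exp (A.logWeight ℓ t ω.1 (A.samples ω t))) ∂A.law ν := by
  have hexp : Measurable fun y : ℝ => ENNReal.ofReal (Real.exp y) := by fun_prop
  induction t with
  | zero => simp [logWeight]
  | succ t ih =>
    rw [A.lintegral_samples_succ ν t
      (F := fun p => ENNReal.ofReal (Real.exp (A.logWeight ℓ (t + 1) p.1 p.2)))
      (hexp.comp (A.measurable_logWeight hℓ (t + 1))), pow_succ]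
    refine (mul_le_mul_left ih ρ).trans ?_
    have hw : Measurable fun ω : A.Outcome =>
        ENNReal.ofReal (Real.exp (A.logWeight ℓ t ω.1 (A.samples ω t))) :=
      (hexp.comp (A.measurable_logWeight hℓ t)).comp
        (measurable_fst.prodMk (A.measurable_samples t))
    rw [← lintegral_mul_const _ hw]
    refine lintegral_mono fun ω => ?_
    simp only [logWeight_snoc, decisionAt]
    cases h' : A.decision t ω.1 (A.samples ω t) with
    -- A padded step contributes the factor `1`, which is why `ρ ≤ 1` is needed.
    | inr o => simpa using mul_le_mul_right hρ _
    | inl q =>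
      simp only [Sum.elim_inl, Real.exp_add, ENNReal.ofReal_mul (Real.exp_pos _).le]
      have hℓq : Measurable fun y => ENNReal.ofReal (Real.exp (ℓ q y)) := hexp.comp (hℓ q)
      rw [lintegral_const_mul _ hℓq]
      exact mul_le_mul_right (h q) _

/-- An average of log-likelihood ratios is thus again a sum of one-step increments, which can be
bounded query by query. -/
lemma logWeight_sum {ι : Type*} (s : Finset ι) (c : ι → ℝ) (ℓ : ι → Fin n × Fin d → ℝ → ℝ)
    (t : ℕ) (a : A.Seed) (h : Fin t → ℝ) :
    A.logWeight (fun q y => ∑ k ∈ s, c k * ℓ k q y) t a h =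
      ∑ k ∈ s, c k * A.logWeight (ℓ k) t a h := by
  induction t with
  | zero => simp [logWeight]
  | succ t ih =>
    simp only [logWeight, ih, mul_add, Finset.sum_add_distrib]
    cases A.decision t a (Fin.init h) <;> simp

lemma logWeight_mono {ℓ ℓ' : Fin n × Fin d → ℝ → ℝ} (hle : ∀ q y, ℓ q y ≤ ℓ' q y)
    (t : ℕ) (a : A.Seed) (h : Fin t → ℝ) : A.logWeight ℓ t a h ≤ A.logWeight ℓ' t a h := by
  induction t with
  | zero => simp [logWeight]
  | succ t ih =>
    refine add_le_add (ih _) ?_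
    cases A.decision t a (Fin.init h) <;> simp [hle]

lemma tendsto_logWeight {ℓ : ℕ → Fin n × Fin d → ℝ → ℝ}
    (hℓ : ∀ q y, Filter.Tendsto (fun k => ℓ k q y) Filter.atTop (nhds 0))
    (t : ℕ) (a : A.Seed) (h : Fin t → ℝ) :
    Filter.Tendsto (fun k => A.logWeight (ℓ k) t a h) Filter.atTop (nhds 0) := by
  induction t with
  | zero => exact tendsto_const_nhds
  | succ t ih =>
    rw [← add_zero (0 : ℝ)]
    refine (ih (Fin.init h)).add ?_
    cases A.decision t a (Fin.init h) <;> simp [hℓ]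

end Algorithm

/-! ### Gaussian problems -/

namespace PerformanceDistribution

variable {n d : ℕ}

/-- The problem with Gaussian samples of unit variance and mean matrix `m`. -/
noncomputable def gaussian (m : Matrix (Fin n) (Fin d) ℝ) : PerformanceDistribution n d :=
  fun i j => ⟨gaussianReal (m i j) 1, inferInstance⟩

@[simp]
lemma coe_gaussian (m : Matrix (Fin n) (Fin d) ℝ) (i : Fin n) (j : Fin d) :
    (gaussian m i j : Measure ℝ) = gaussianReal (m i j) 1 := rfl

@[simp]
lemma mean_gaussian (m : Matrix (Fin n) (Fin d) ℝ) : (gaussian m).mean = m := by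
  ext i j
  simp [mean]

lemma isSubGaussian_gaussian (m : Matrix (Fin n) (Fin d) ℝ) : (gaussian m).IsSubGaussian := by
  intro i j
  have hmap : (gaussianReal (m i j) 1).map (fun z => z - m i j) = gaussianReal 0 1 := by
    simpa using gaussianReal_map_sub_const (μ := m i j) (v := 1) (m i j)
  rw [mean_gaussian, coe_gaussian]
  refine ⟨fun t => ?_, fun t => ?_⟩
  · have h := integrable_exp_mul_gaussianReal (μ := m i j) (v := 1) t
    refine (h.mul_const (Real.exp (-(t * m i j)))).congr (Filter.Eventually.of_forall fun z => ?_)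
    simp only [← Real.exp_add]
    ring_nf
  · rw [mgf_gaussianReal hmap]
    simp

end PerformanceDistribution

lemma gaussianReal_add_eq_withDensity (m v : ℝ) :
    gaussianReal (m + v) 1 = (gaussianReal m 1).withDensity
      fun y => ENNReal.ofReal (Real.exp (v * (y - m) - v ^ 2 / 2)) := by
  rw [gaussianReal_of_var_ne_zero _ one_ne_zero, gaussianReal_of_var_ne_zero _ one_ne_zero,
    ← withDensity_mul _ (measurable_gaussianPDF _ _) (by fun_prop)]
  congr 1
  ext y
  simp only [gaussianPDF, Pi.mul_apply]
  rw [← ENNReal.ofReal_mul (gaussianPDFReal_nonneg _ _ _)]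
  congr 1
  simp only [gaussianPDFReal, mul_assoc, ← Real.exp_add]
  congr 3
  simp
  ring

/-- The integral equals `exp (c ^ 2 / 2 - s)`. Dropping `c ^ 2 / 2` leaves a bound that does not
depend on the slope, hence not on the queried pair. -/
lemma ofReal_exp_neg_le_lintegral_gaussianReal (m c s : ℝ) :
    ENNReal.ofReal (Real.exp (-s)) ≤
      ∫⁻ y, ENNReal.ofReal (Real.exp (c * (y - m) - s)) ∂gaussianReal m 1 := by
  have h1 : ∫⁻ y, ENNReal.ofReal (Real.exp (c * (y - m) - c ^ 2 / 2)) ∂gaussianReal m 1 = 1 := by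
    rw [← setLIntegral_univ, ← withDensity_apply _ MeasurableSet.univ,
      ← gaussianReal_add_eq_withDensity]
    simp
  calc ENNReal.ofReal (Real.exp (-s))
      = ∫⁻ y, ENNReal.ofReal (Real.exp (-s)) *
          ENNReal.ofReal (Real.exp (c * (y - m) - c ^ 2 / 2)) ∂gaussianReal m 1 := by
        rw [lintegral_const_mul _ (by fun_prop), h1, mul_one]
    _ ≤ _ := by
        refine lintegral_mono fun y => ?_
        rw [← ENNReal.ofReal_mul (Real.exp_pos _).le, ← Real.exp_add]
        refine ENNReal.ofReal_le_ofReal (Real.exp_le_exp.2 ?_)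
        nlinarith [sq_nonneg c]

/-! ### Stopping events and change of measure -/

namespace Algorithm

open PerformanceDistribution

variable {n d : ℕ} {O : Type} (A : Algorithm n d O)

/-- The events that are determined by the seed and the first `T` samples. -/
abbrev historySpace (T : ℕ) : MeasurableSpace A.Outcome :=
  MeasurableSpace.comap (fun ω => (ω.1, A.samples ω T)) inferInstance

lemma samples_apply (ω : A.Outcome) (t : ℕ) (i : Fin t) :
    A.samples ω t i =
      Sum.elim (fun q => ω.2 i q) (fun _ => 0) (A.decision i ω.1 (A.samples ω i)) := by
  induction t with
  | zero => exact i.elim0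
  | succ t ih =>
    induction i using Fin.lastCases with
    | last => simp [samples]
    | cast i => simpa [samples] using ih i

lemma samples_eq_castLE (ω : A.Outcome) {t T : ℕ} (h : t ≤ T) :
    A.samples ω t = fun i => A.samples ω T (Fin.castLE h i) := by
  ext i
  rw [samples_apply, samples_apply, Fin.val_castLE]

lemma measurableSet_historySpace_preimage {t T : ℕ} (h : t ≤ T)
    {s : Set (A.Seed × (Fin t → ℝ))} (hs : MeasurableSet s) :
    MeasurableSet[A.historySpace T] {ω | (ω.1, A.samples ω t) ∈ s} := by
  have hf : Measurable fun p : A.Seed × (Fin T → ℝ) => (p.1, fun i => p.2 (Fin.castLE h i)) :=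
    measurable_fst.prodMk (measurable_pi_lambda _ fun i =>
      (measurable_pi_apply (Fin.castLE h i)).comp measurable_snd)
  refine ⟨_, hf hs, ?_⟩
  ext ω
  simp [A.samples_eq_castLE ω h]

/-- The event that more than `T` queries are made. -/
def continues (T : ℕ) : Set A.Outcome :=
  {ω | ∀ t ≤ T, ¬ (A.decisionAt ω t).isRight}

/-- The event that at most `T` queries are made and the output is not `b`. -/
def stopsWrong (T : ℕ) (b : O) : Set A.Outcome :=
  {ω | ∃ t ≤ T, (∀ s < t, ¬ (A.decisionAt ω s).isRight) ∧
    (A.decisionAt ω t).isRight ∧ A.decisionAt ω t ≠ Sum.inr b}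

/-- The decision at time `T` sees only `T` samples, so making at least `T + 1` queries is an event
with only `T` likelihood factors. -/
lemma measurableSet_continues (T : ℕ) : MeasurableSet[A.historySpace T] (A.continues T) := by
  have h : A.continues T = ⋂ (t : ℕ) (_ : t ≤ T), {ω | (A.decisionAt ω t).isRight}ᶜ := by
    ext ω; simp [continues]
  rw [h]
  exact @MeasurableSet.iInter _ _ (A.historySpace T) _ _ fun t =>
    @MeasurableSet.iInter _ _ (A.historySpace T) _ _ fun ht =>
      (A.measurableSet_historySpace_preimage ht (A.measurableSet_isRight t)).compl

lemma measurableSet_stopsWrong (T : ℕ) (b : O) :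
    MeasurableSet[A.historySpace T] (A.stopsWrong T b) := by
  have h : A.stopsWrong T b = ⋃ (t : ℕ) (_ : t ≤ T),
      ((⋂ (s : ℕ) (_ : s < t), {ω | (A.decisionAt ω s).isRight}ᶜ) ∩
        ({ω | (A.decisionAt ω t).isRight} ∩ {ω | A.decisionAt ω t = Sum.inr b}ᶜ)) := by
    ext ω
    simp only [stopsWrong, Set.mem_ofPred_eq, Set.mem_iUnion, Set.mem_inter_iff, Set.mem_iInter,
      Set.mem_compl_iff, exists_prop, ne_eq]
  rw [h]
  refine @MeasurableSet.iUnion _ _ (A.historySpace T) _ _ fun t =>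
    @MeasurableSet.iUnion _ _ (A.historySpace T) _ _ fun ht =>
      @MeasurableSet.inter _ (A.historySpace T) _ _ ?_ ?_
  · exact @MeasurableSet.iInter _ _ (A.historySpace T) _ _ fun s =>
      @MeasurableSet.iInter _ _ (A.historySpace T) _ _ fun hs =>
        (A.measurableSet_historySpace_preimage (hs.le.trans ht) (A.measurableSet_isRight s)).compl
  · exact @MeasurableSet.inter _ (A.historySpace T) _ _
      (A.measurableSet_historySpace_preimage ht (A.measurableSet_isRight t))
      (A.measurableSet_historySpace_preimage ht (A.measurableSet_decision t _)).compl

lemma historySpace_le (T : ℕ) : A.historySpace T ≤ (inferInstance : MeasurableSpace A.Outcome) :=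
  (measurable_fst.prodMk (A.measurable_samples T)).comap_le

lemma continues_subset_le_numQueries {T : ℕ} {x : ℝ} (hx : x ≤ T + 1) :
    A.continues T ⊆ {ω | ENNReal.ofReal x ≤ (A.numQueries ω : ℝ≥0∞)} := by
  intro ω hω
  have h : ((T + 1 : ℕ) : ℕ∞) ≤ A.numQueries ω := by
    refine le_iInf₂ fun t ht => ?_
    rw [Nat.cast_le]
    by_contra hlt
    exact hω t (by omega) ht
  calc ENNReal.ofReal x ≤ ENNReal.ofReal ((T + 1 : ℕ) : ℝ) :=
        ENNReal.ofReal_le_ofReal (by exact_mod_cast hx)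
    _ = (((T + 1 : ℕ) : ℕ∞) : ℝ≥0∞) := by rw [ENNReal.ofReal_natCast]; simp
    _ ≤ _ := by exact_mod_cast h

lemma stopsWrong_subset_outputs (T : ℕ) (b : O) :
    A.stopsWrong T b ⊆ {ω | ∃ o, A.Outputs ω o ∧ o ≠ b} := by
  rintro ω ⟨t, -, hlt, hr, hne⟩
  obtain ⟨o, ho⟩ := Sum.isRight_iff.1 hr
  refine ⟨o, ⟨t, le_antisymm (iInf₂_le t hr) (le_iInf₂ fun s hs => ?_), ho⟩, ?_⟩
  · rw [Nat.cast_le]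
    by_contra h
    exact hlt s (by omega) hs
  · rintro rfl
    exact hne ho

/-- The output at the first stopping time cannot be both `b` and `b'`. This is all that the lower
bound needs to know about outputs. -/
lemma compl_continues_subset (T : ℕ) {b b' : O} (hb : b ≠ b') :
    (A.continues T)ᶜ ⊆ A.stopsWrong T b ∪ A.stopsWrong T b' := by
  classical
  intro ω hω
  have hex : ∃ t, t ≤ T ∧ (A.decisionAt ω t).isRight := by
    simpa [continues] using hω
  have hmin : ∀ s < Nat.find hex, ¬ (A.decisionAt ω s).isRight := fun s hs hr =>
    Nat.find_min hex hs ⟨hs.le.trans (Nat.find_spec hex).1, hr⟩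
  obtain ⟨hle, hr⟩ := Nat.find_spec hex
  by_cases h : A.decisionAt ω (Nat.find hex) = Sum.inr b
  · exact Or.inr ⟨_, hle, hmin, hr, by simpa [h] using hb⟩
  · exact Or.inl ⟨_, hle, hmin, hr, h⟩

/-- The logarithm of the likelihood ratio of a sample, for Gaussian problems whose mean matrices
are `m + v` and `m`. -/
noncomputable def gaussianLogRatio (m v : Matrix (Fin n) (Fin d) ℝ) (q : Fin n × Fin d) (y : ℝ) : ℝ :=
  v q.1 q.2 * (y - m q.1 q.2) - v q.1 q.2 ^ 2 / 2

lemma measurable_gaussianLogRatio (m v : Matrix (Fin n) (Fin d) ℝ) (q : Fin n × Fin d) :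
    Measurable (gaussianLogRatio m v q) := by
  unfold gaussianLogRatio
  fun_prop

lemma measurable_ofReal_exp_logWeight {ℓ : Fin n × Fin d → ℝ → ℝ} (hℓ : ∀ q, Measurable (ℓ q))
    (c : ℝ) (T : ℕ) : Measurable fun ω : A.Outcome =>
      ENNReal.ofReal (Real.exp (c * A.logWeight ℓ T ω.1 (A.samples ω T))) :=
  ENNReal.measurable_ofReal.comp (Real.measurable_exp.comp (((A.measurable_logWeight hℓ T).comp
    (measurable_fst.prodMk (A.measurable_samples T))).const_mul c))

lemma law_gaussian_add_apply (m v : Matrix (Fin n) (Fin d) ℝ) {T : ℕ} {E : Set A.Outcome}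
    (hE : MeasurableSet[A.historySpace T] E) :
    A.law (gaussian (m + v)) E = ∫⁻ ω in E, ENNReal.ofReal
      (Real.exp (A.logWeight (gaussianLogRatio m v) T ω.1 (A.samples ω T)))
      ∂A.law (gaussian m) := by
  have hE' := A.historySpace_le T _ hE
  obtain ⟨B, hB, rfl⟩ := hE
  have h := A.lintegral_samples_eq_weight (ν := gaussian m) (ν' := gaussian (m + v))
    (measurable_gaussianLogRatio m v)
    (fun q => gaussianReal_add_eq_withDensity (m q.1 q.2) (v q.1 q.2)) T
    (measurable_one.indicator hB)
  rw [← lintegral_indicator hE', ← lintegral_indicator_one hE']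
  refine h.trans (lintegral_congr fun ω => ?_)
  by_cases hω : (ω.1, A.samples ω T) ∈ B <;> simp [hω, Set.indicator]

/-- The probability of an event that is determined by finitely many samples is lower
semicontinuous along a segment of Gaussian problems. -/
lemma law_gaussian_le_of_forall (m v : Matrix (Fin n) (Fin d) ℝ) {T : ℕ} {E : Set A.Outcome}
    (hE : MeasurableSet[A.historySpace T] E) {p : ℝ≥0∞}
    (h : ∀ k : ℕ, A.law (gaussian (m + (1 / ((k : ℝ) + 1)) • v)) E ≤ p) :
    A.law (gaussian m) E ≤ p := by
  have hlim (ω : A.Outcome) : Filter.Tendsto (fun k : ℕ => ENNReal.ofReal (Real.exp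
      (A.logWeight (gaussianLogRatio m ((1 / ((k : ℝ) + 1)) • v)) T ω.1 (A.samples ω T))))
      Filter.atTop (nhds 1) := by
    rw [← ENNReal.ofReal_one, ← Real.exp_zero]
    refine (ENNReal.continuous_ofReal.tendsto _).comp ((Real.continuous_exp.tendsto _).comp
      (A.tendsto_logWeight (fun q y => ?_) T _ _))
    have h0 := (tendsto_one_div_add_atTop_nhds_zero_nat (𝕜 := ℝ)).mul_const (v q.1 q.2)
    simpa [gaussianLogRatio] using (h0.mul_const (y - m q.1 q.2)).sub ((h0.pow 2).div_const 2)
  have hmeas (k : ℕ) : Measurable fun ω : A.Outcome => ENNReal.ofReal (Real.exp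
      (A.logWeight (gaussianLogRatio m ((1 / ((k : ℝ) + 1)) • v)) T ω.1 (A.samples ω T))) := by
    simpa using A.measurable_ofReal_exp_logWeight
      (measurable_gaussianLogRatio m ((1 / ((k : ℝ) + 1)) • v)) 1 T
  -- Fatou's lemma under the limit problem: the likelihood ratios of the nearby problems tend to `1`
  -- pointwise.
  calc A.law (gaussian m) E = ∫⁻ ω in E, Filter.liminf (fun k : ℕ => ENNReal.ofReal (Real.exp
      (A.logWeight (gaussianLogRatio m ((1 / ((k : ℝ) + 1)) • v)) T ω.1 (A.samples ω T))))
        Filter.atTop ∂A.law (gaussian m) := by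
        simp only [(hlim _).liminf_eq, setLIntegral_one]
    _ ≤ Filter.liminf (fun k : ℕ => A.law (gaussian (m + (1 / ((k : ℝ) + 1)) • v)) E)
        Filter.atTop := by
        simp only [A.law_gaussian_add_apply m _ hE]
        exact lintegral_liminf_le hmeas
    _ ≤ p := Filter.liminf_le_of_frequently_le' (Filter.Frequently.of_forall h)

/-- Bound for the Bhattacharyya coefficient of two Gaussian problems on an event. -/
lemma setLIntegral_sqrt_weight_le (m v : Matrix (Fin n) (Fin d) ℝ) {T : ℕ} {E : Set A.Outcome}
    (hE : MeasurableSet[A.historySpace T] E) {c : ℝ} (hc : 0 < c) :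
    ∫⁻ ω in E, ENNReal.ofReal (Real.exp
      (1 / 2 * A.logWeight (gaussianLogRatio m v) T ω.1 (A.samples ω T))) ∂A.law (gaussian m) ≤
      ENNReal.ofReal (c / 2) * A.law (gaussian m) E +
        ENNReal.ofReal (1 / (2 * c)) * A.law (gaussian (m + v)) E := by
  have hmeas := A.measurable_ofReal_exp_logWeight (measurable_gaussianLogRatio m v) 1 T
  simp only [one_mul] at hmeas
  rw [A.law_gaussian_add_apply m v hE, ← lintegral_const_mul _ hmeas, ← setLIntegral_const,
    ← lintegral_add_left measurable_const]
  refine lintegral_mono fun ω => ?_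
  rw [← ENNReal.ofReal_mul (by positivity), ← ENNReal.ofReal_add (by positivity) (by positivity)]
  refine ENNReal.ofReal_le_ofReal ?_
  generalize A.logWeight (gaussianLogRatio m v) T ω.1 (A.samples ω T) = L
  have hL : Real.exp L = Real.exp (1 / 2 * L) ^ 2 := by
    rw [← Real.exp_nat_mul]; congr 1; push_cast; ring
  rw [hL]
  -- The inequality of arithmetic and geometric means with a free constant `c` replaces
  -- Cauchy–Schwarz.
  have h : c / 2 + 1 / (2 * c) * Real.exp (1 / 2 * L) ^ 2 - Real.exp (1 / 2 * L) =
      (Real.exp (1 / 2 * L) - c) ^ 2 / (2 * c) := by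
    field_simp; ring
  have h' : 0 ≤ (Real.exp (1 / 2 * L) - c) ^ 2 / (2 * c) := by positivity
  linarith

/-- A lower bound for the average of the Bhattacharyya coefficients of shifted Gaussian problems
whose squared shifts are bounded by `S` on average. -/
lemma exp_le_average_sqrt_weight {ι : Type*} [Fintype ι] [Nonempty ι]
    (m : Matrix (Fin n) (Fin d) ℝ) (v : ι → Matrix (Fin n) (Fin d) ℝ) {S : ℝ} (hS₀ : 0 ≤ S)
    (hS : ∀ i j, ∑ k, v k i j ^ 2 ≤ Fintype.card ι * S) (T : ℕ) :
    ENNReal.ofReal (Real.exp (-(T * S / 4))) ≤ ∑ k : ι, ENNReal.ofReal (1 / Fintype.card ι) *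
      ∫⁻ ω, ENNReal.ofReal (Real.exp
        (1 / 2 * A.logWeight (gaussianLogRatio m (v k)) T ω.1 (A.samples ω T)))
        ∂A.law (gaussian m) := by
  have hcard : (0 : ℝ) < Fintype.card ι := by exact_mod_cast Fintype.card_pos
  -- The averaged half log-ratio, with its quadratic term replaced by the uniform bound `S / 4`.
  let ℓ : Fin n × Fin d → ℝ → ℝ := fun q y =>
    (∑ k, 1 / Fintype.card ι * (1 / 2) * v k q.1 q.2) * (y - m q.1 q.2) - S / 4
  have hℓ : ∀ q, Measurable (ℓ q) := fun q => by fun_prop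
  have hmeas (k : ι) := A.measurable_ofReal_exp_logWeight (measurable_gaussianLogRatio m (v k))
    (1 / 2) T
  have hle (q : Fin n × Fin d) (y : ℝ) :
      ℓ q y ≤ ∑ k, 1 / Fintype.card ι * (1 / 2) * gaussianLogRatio m (v k) q y := by
    have h1 : ∑ k, 1 / Fintype.card ι * (1 / 2) * gaussianLogRatio m (v k) q y =
        (∑ k, 1 / Fintype.card ι * (1 / 2) * v k q.1 q.2) * (y - m q.1 q.2) -
          1 / Fintype.card ι * (1 / 4) * ∑ k, v k q.1 q.2 ^ 2 := by
      rw [Finset.sum_mul, Finset.mul_sum, ← Finset.sum_sub_distrib]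
      refine Finset.sum_congr rfl fun k _ => ?_
      unfold gaussianLogRatio
      ring
    have h2 : 1 / Fintype.card ι * (1 / 4) * ∑ k, v k q.1 q.2 ^ 2 ≤ S / 4 := by
      calc 1 / Fintype.card ι * (1 / 4) * ∑ k, v k q.1 q.2 ^ 2
          ≤ 1 / Fintype.card ι * (1 / 4) * (Fintype.card ι * S) := by gcongr; exact hS _ _
        _ = S / 4 := by field_simp
    rw [h1]
    exact sub_le_sub_left h2 _
  calc ENNReal.ofReal (Real.exp (-(T * S / 4)))
      = ENNReal.ofReal (Real.exp (-(S / 4))) ^ T := by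
        rw [← ENNReal.ofReal_pow (Real.exp_pos _).le, ← Real.exp_nat_mul]
        congr 2; ring
    _ ≤ ∫⁻ ω, ENNReal.ofReal (Real.exp (A.logWeight ℓ T ω.1 (A.samples ω T)))
        ∂A.law (gaussian m) := by
        refine A.pow_le_lintegral_weight hℓ ?_ (fun q => ?_) T
        · rw [← ENNReal.ofReal_one]
          exact ENNReal.ofReal_le_ofReal (Real.exp_le_one_iff.2 (by linarith))
        · exact ofReal_exp_neg_le_lintegral_gaussianReal _ _ _
    _ ≤ ∫⁻ ω, ∑ k : ι, ENNReal.ofReal (1 / Fintype.card ι) * ENNReal.ofReal (Real.exp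
        (1 / 2 * A.logWeight (gaussianLogRatio m (v k)) T ω.1 (A.samples ω T)))
        ∂A.law (gaussian m) := by
        refine lintegral_mono fun ω => ?_
        have h1 := A.logWeight_mono hle T ω.1 (A.samples ω T)
        rw [logWeight_sum] at h1
        -- Jensen's inequality over the shifts, for a fixed outcome.
        have h2 := convexOn_exp.map_sum_le (t := Finset.univ)
          (w := fun _ : ι => (1 / Fintype.card ι : ℝ))
          (p := fun k => 1 / 2 * A.logWeight (gaussianLogRatio m (v k)) T ω.1 (A.samples ω T))
          (fun _ _ => by positivity) (by simp [hcard.ne']) (fun _ _ => Set.mem_univ _)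
        simp only [smul_eq_mul, ← mul_assoc] at h2
        simp_rw [← ENNReal.ofReal_mul (show (0 : ℝ) ≤ 1 / Fintype.card ι by positivity)]
        rw [← ENNReal.ofReal_sum_of_nonneg (fun _ _ => by positivity)]
        refine ENNReal.ofReal_le_ofReal ((Real.exp_le_exp.2 h1).trans (h2.trans ?_))
        exact le_rfl
    _ = _ := by
        rw [lintegral_finsetSum _ fun k _ => (hmeas k).const_mul _]
        exact Finset.sum_congr rfl fun k _ => lintegral_const_mul _ (hmeas k)

/-- An event that is determined by `T` samples and likely on a Gaussian problem is not too unlikely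
on all of its shifts. -/
lemma exists_le_law_gaussian_add {ι : Type*} [Fintype ι] [Nonempty ι]
    (m : Matrix (Fin n) (Fin d) ℝ) (v : ι → Matrix (Fin n) (Fin d) ℝ) {S : ℝ} (hS₀ : 0 ≤ S)
    (hS : ∀ i j, ∑ k, v k i j ^ 2 ≤ Fintype.card ι * S) {T : ℕ} {E : Set A.Outcome}
    (hE : MeasurableSet[A.historySpace T] E) {δ : ℝ} (hδ : 0 < δ)
    (h₀ : A.law (gaussian m) Eᶜ ≤ ENNReal.ofReal (2 * δ))
    (hT : 6 * δ ≤ Real.exp (-(T * S / 2))) :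
    ∃ k, ENNReal.ofReal δ ≤ A.law (gaussian (m + v k)) E := by
  by_contra! hlt
  have hcard : (0 : ℝ) < Fintype.card ι := by exact_mod_cast Fintype.card_pos
  have hE' : MeasurableSet E := A.historySpace_le T _ hE
  have hs : 0 < √δ := Real.sqrt_pos.2 hδ
  have hs2 : 0 < √(2 * δ) := Real.sqrt_pos.2 (by linarith)
  have hss : √δ ^ 2 = δ := Real.sq_sqrt hδ.le
  have hss2 : √(2 * δ) ^ 2 = 2 * δ := Real.sq_sqrt (by linarith)
  -- On `E` the two probabilities are at most `1` and `δ`, on `Eᶜ` at most `2 * δ` and `1`. The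
  -- constants `√δ` and `1 / √(2 * δ)` balance the two terms of the bound in each case.
  have hk (k : ι) : ∫⁻ ω, ENNReal.ofReal (Real.exp
      (1 / 2 * A.logWeight (gaussianLogRatio m (v k)) T ω.1 (A.samples ω T)))
      ∂A.law (gaussian m) ≤ ENNReal.ofReal (√δ + √(2 * δ)) := by
    rw [← lintegral_add_compl _ hE', ENNReal.ofReal_add hs.le hs2.le]
    refine add_le_add ?_ ?_
    · refine (A.setLIntegral_sqrt_weight_le m (v k) hE hs).trans ?_
      calc _ ≤ ENNReal.ofReal (√δ / 2) * 1 + ENNReal.ofReal (1 / (2 * √δ)) * ENNReal.ofReal δ := by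
            gcongr
            · exact prob_le_one
            · exact (hlt k).le
        _ = ENNReal.ofReal √δ := by
            rw [mul_one, ← ENNReal.ofReal_mul (by positivity),
              ← ENNReal.ofReal_add (by positivity) (by positivity)]
            congr 1
            field_simp
            linarith
    · refine (A.setLIntegral_sqrt_weight_le m (v k) hE.compl
        (c := 1 / √(2 * δ)) (by positivity)).trans ?_
      calc _ ≤ ENNReal.ofReal (1 / √(2 * δ) / 2) * ENNReal.ofReal (2 * δ) +
            ENNReal.ofReal (1 / (2 * (1 / √(2 * δ)))) * 1 := by
            gcongr
            exact prob_le_one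
        _ = ENNReal.ofReal √(2 * δ) := by
            rw [mul_one, ← ENNReal.ofReal_mul (by positivity),
              ← ENNReal.ofReal_add (by positivity) (by positivity)]
            congr 1
            rw [← hss2]
            field_simp
            rw [Real.sqrt_sq hs2.le]
            ring
  have h1 : ENNReal.ofReal (Real.exp (-(T * S / 4))) ≤ ENNReal.ofReal (√δ + √(2 * δ)) := by
    refine (A.exp_le_average_sqrt_weight m v hS₀ hS T).trans ?_
    calc _ ≤ ∑ k : ι, ENNReal.ofReal (1 / Fintype.card ι) * ENNReal.ofReal (√δ + √(2 * δ)) := by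
          gcongr with k
          exact hk k
      _ = _ := by
          simp_rw [← ENNReal.ofReal_mul (show (0 : ℝ) ≤ 1 / Fintype.card ι by positivity)]
          rw [← ENNReal.ofReal_sum_of_nonneg (fun _ _ => by positivity)]
          congr 1
          simp only [Finset.sum_const, Finset.card_univ, nsmul_eq_mul]
          field_simp
  rw [ENNReal.ofReal_le_ofReal_iff (by positivity)] at h1
  have h2 : Real.exp (-(T * S / 2)) = Real.exp (-(T * S / 4)) ^ 2 := by
    rw [← Real.exp_nat_mul]; congr 1; push_cast; ring
  have h3 : Real.exp (-(T * S / 4)) ^ 2 ≤ (√δ + √(2 * δ)) ^ 2 := by gcongr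
  -- The square hint encodes `√2 ≤ 17 / 12`, so `(1 + √2) ^ 2 ≤ 35 / 6 < 6`; this is the origin of
  -- the constant `6`.
  nlinarith [sq_nonneg (3 * √δ - 2 * √(2 * δ)), mul_pos hs hs2]

end Algorithm

/-! ### Rankings and gaps of two experts -/

lemma isRanking_two_iff {d : ℕ} {M : Matrix (Fin 2) (Fin d) ℝ} {π : Equiv.Perm (Fin 2)} :
    IsRanking M π ↔ ∀ j, M (π 1) j ≤ M (π 0) j := by
  refine forall_congr' fun j => ⟨fun h => h (Fin.zero_le 1), fun h i k hik => ?_⟩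
  fin_cases i <;> fin_cases k <;> simp_all

lemma mem_rankingMatrices_two {d : ℕ} {M : Matrix (Fin 2) (Fin d) ℝ} {π : Equiv.Perm (Fin 2)}
    (hπ : IsRanking M π) (h01 : ∀ i j, M i j ∈ Set.Icc (0 : ℝ) 1) (hne : ∃ j, M 0 j ≠ M 1 j) :
    M ∈ rankingMatrices 2 d := by
  refine ⟨⟨⟨π, hπ⟩, h01⟩, fun i k hik => ?_⟩
  obtain ⟨j, hj⟩ := hne
  refine ⟨j, ?_⟩
  fin_cases i <;> fin_cases k
  · exact absurd rfl hik
  · exact hj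
  · exact hj.symm
  · exact absurd rfl hik

lemma rankingMatrices_subset_bestExpertMatrices (n d : ℕ) [NeZero n] :
    rankingMatrices n d ⊆ bestExpertMatrices n d :=
  fun _ hM => ⟨hM.1, fun π _ _ hi => hM.2 _ _ (π.injective.ne hi)⟩

section gap

variable {d : ℕ} (M : Matrix (Fin 2) (Fin d) ℝ)

lemma gap_nonneg (j : Fin d) : 0 ≤ gap M j := abs_nonneg _

lemma gap_eq_sub {π : Equiv.Perm (Fin 2)} (hπ : IsRanking M π) (j : Fin d) :
    gap M j = M (π 0) j - M (π 1) j := by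
  have h := isRanking_two_iff.1 hπ j
  rw [← abs_of_nonneg (sub_nonneg.2 h), gap]
  have h01 : π 0 ≠ π 1 := π.injective.ne (by decide)
  generalize π 0 = a at *
  generalize π 1 = b at *
  fin_cases a <;> fin_cases b
  · exact absurd rfl h01
  · rfl
  · exact abs_sub_comm _ _
  · exact absurd rfl h01

lemma norm_sq_eq_sum_gap_sq :
    ‖WithLp.toLp 2 (M 0 - M 1)‖ ^ 2 = ∑ j, gap M j ^ 2 := by
  rw [EuclideanSpace.norm_sq_eq]
  simp [gap]

lemma sum_gap_add_sq [NeZero d] (j : Fin d) :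
    ∑ k, gap M (j + k) ^ 2 = ∑ k, gap M k ^ 2 :=
  Equiv.sum_comp (Equiv.addLeft j) fun k => gap M k ^ 2

variable {M}

lemma exists_gap_pos (hM : M ∈ rankingMatrices 2 d) : ∃ j, 0 < gap M j := by
  obtain ⟨j, hj⟩ := hM.2 0 1 (by decide)
  exact ⟨j, abs_pos.2 (sub_ne_zero.2 hj)⟩

lemma gap_le_one (hM : M ∈ rankingMatrices 2 d) (j : Fin d) : gap M j ≤ 1 := by
  have h0 := hM.1.2 0 j
  have h1 := hM.1.2 1 j
  exact abs_le.2 ⟨by linarith [h0.1, h1.2], by linarith [h0.2, h1.1]⟩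

end gap

/-! ### Lower bounds for accurate algorithms -/

namespace Algorithm

open PerformanceDistribution

variable {d : ℕ} {O : Type}

/-- `f π` is the correct output on problems with ranking `π`, and a wrong output has probability
at most `δ` on every sub-Gaussian problem with an admissible mean matrix. -/
def IsAccurateFor (A : Algorithm 2 d O) (f : Equiv.Perm (Fin 2) → O) (δ : ℝ) : Prop :=
  ∀ ν : PerformanceDistribution 2 d, ν.IsSubGaussian → ν.mean ∈ rankingMatrices 2 d →
    ∀ π, IsRanking ν.mean π → (A.law ν).real {ω | ∃ o, A.Outputs ω o ∧ o ≠ f π} ≤ δ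

variable {A : Algorithm 2 d O} {f : Equiv.Perm (Fin 2) → O} {δ : ℝ}

lemma IsAccurateFor.law_stopsWrong_le (hA : A.IsAccurateFor f δ) {π : Equiv.Perm (Fin 2)}
    {M : Matrix (Fin 2) (Fin d) ℝ} (hM : M ∈ rankingMatrices 2 d) (hπ : IsRanking M π) (T : ℕ) :
    A.law (gaussian M) (A.stopsWrong T (f π)) ≤ ENNReal.ofReal δ := by
  have h := hA (gaussian M) (isSubGaussian_gaussian M) (by simpa using hM) π (by simpa using hπ)
  refine (measure_mono (A.stopsWrong_subset_outputs T (f π))).trans ?_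
  rw [← ENNReal.ofReal_toReal (measure_ne_top (A.law (gaussian M)) _)]
  exact ENNReal.ofReal_le_ofReal h

variable {w u : Fin d → ℝ}

/-- An accurate algorithm rarely stops on a Gaussian problem whose two experts are equal. -/
lemma IsAccurateFor.law_compl_continues_le (hA : A.IsAccurateFor f δ) (hδ : 0 ≤ δ)
    (hf : f 1 ≠ f (Equiv.swap 0 1)) (hw : ∀ j, 0 ≤ w j) (hu : ∀ j, 0 ≤ u j)
    (hwu : ∀ j, w j + u j ≤ 1) (hne : ∃ j, 0 < u j) (T : ℕ) :
    A.law (gaussian (Matrix.of ![w, w])) (A.continues T)ᶜ ≤ ENNReal.ofReal (2 * δ) := by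
  have hk (k : ℕ) : 0 < 1 / ((k : ℝ) + 1) ∧ 1 / ((k : ℝ) + 1) ≤ 1 := by
    refine ⟨by positivity, ?_⟩
    rw [div_le_one (by positivity)]
    linarith [Nat.cast_nonneg (α := ℝ) k]
  have hb (k : ℕ) (j : Fin d) : 0 ≤ 1 / ((k : ℝ) + 1) * u j ∧ 1 / ((k : ℝ) + 1) * u j ≤ u j :=
    ⟨mul_nonneg (hk k).1.le (hu j), mul_le_of_le_one_left (hu j) (hk k).2⟩
  obtain ⟨j₀, hj₀⟩ := hne
  have hj (k : ℕ) : 0 < 1 / ((k : ℝ) + 1) * u j₀ := mul_pos (hk k).1 hj₀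
  -- Raising expert `0` by small multiples of `u` keeps the means in `[0,1]` and makes `f 1` the
  -- correct output; raising expert `1` below does the same for the swap.
  have h0 : A.law (gaussian (Matrix.of ![w, w])) (A.stopsWrong T (f 1)) ≤ ENNReal.ofReal δ := by
    refine A.law_gaussian_le_of_forall _ (Matrix.of ![u, 0]) (A.measurableSet_stopsWrong T _)
      fun k => ?_
    have hπ : IsRanking (Matrix.of ![w, w] + (1 / ((k : ℝ) + 1)) • Matrix.of ![u, 0]) 1 :=
      isRanking_two_iff.2 fun j => by simpa using (hb k j).1
    refine hA.law_stopsWrong_le (mem_rankingMatrices_two hπ (fun i j => ?_) ⟨j₀, ?_⟩) hπ T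
    · have h1 := hb k j
      have h2 := hw j
      have h3 := hwu j
      have h4 := hu j
      fin_cases i
      · change 0 ≤ w j + 1 / ((k : ℝ) + 1) * u j ∧ w j + 1 / ((k : ℝ) + 1) * u j ≤ 1
        constructor <;> linarith
      · change 0 ≤ w j + 1 / ((k : ℝ) + 1) * 0 ∧ w j + 1 / ((k : ℝ) + 1) * 0 ≤ 1
        constructor <;> linarith
    · change w j₀ + 1 / ((k : ℝ) + 1) * u j₀ ≠ w j₀ + 1 / ((k : ℝ) + 1) * 0
      linarith [hj k]
  have h1 : A.law (gaussian (Matrix.of ![w, w])) (A.stopsWrong T (f (Equiv.swap 0 1))) ≤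
      ENNReal.ofReal δ := by
    refine A.law_gaussian_le_of_forall _ (Matrix.of ![0, u]) (A.measurableSet_stopsWrong T _)
      fun k => ?_
    have hπ : IsRanking (Matrix.of ![w, w] + (1 / ((k : ℝ) + 1)) • Matrix.of ![0, u])
        (Equiv.swap 0 1) :=
      isRanking_two_iff.2 fun j => by simpa using (hb k j).1
    refine hA.law_stopsWrong_le (mem_rankingMatrices_two hπ (fun i j => ?_) ⟨j₀, ?_⟩) hπ T
    · have h1 := hb k j
      have h2 := hw j
      have h3 := hwu j
      have h4 := hu j
      fin_cases i
      · change 0 ≤ w j + 1 / ((k : ℝ) + 1) * 0 ∧ w j + 1 / ((k : ℝ) + 1) * 0 ≤ 1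
        constructor <;> linarith
      · change 0 ≤ w j + 1 / ((k : ℝ) + 1) * u j ∧ w j + 1 / ((k : ℝ) + 1) * u j ≤ 1
        constructor <;> linarith
    · change w j₀ + 1 / ((k : ℝ) + 1) * 0 ≠ w j₀ + 1 / ((k : ℝ) + 1) * u j₀
      linarith [hj k]
  calc _ ≤ _ := measure_mono (A.compl_continues_subset T hf)
    _ ≤ _ := measure_union_le _ _
    _ ≤ ENNReal.ofReal δ + ENNReal.ofReal δ := add_le_add h0 h1
    _ = _ := by rw [← ENNReal.ofReal_add hδ hδ, two_mul]

/-- The direction `u` serves only to approach the equal-row problem through admissible ones. The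
shifts `v` are independent of it and may leave `[0,1]`. -/
lemma IsAccurateFor.exists_le_probQueriesGE [NeZero d] (hA : A.IsAccurateFor f δ)
    (hδ : δ ∈ Set.Ioo (0 : ℝ) (1 / 4)) (hf : f 1 ≠ f (Equiv.swap 0 1)) (hw : ∀ j, 0 ≤ w j)
    (hu : ∀ j, 0 ≤ u j) (hwu : ∀ j, w j + u j ≤ 1) (hne : ∃ j, 0 < u j)
    {M₀ : Matrix (Fin 2) (Fin d) ℝ} (hM₀ : M₀ ∈ rankingMatrices 2 d)
    (v : Fin d → Matrix (Fin 2) (Fin d) ℝ)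
    (hv : ∀ i j, ∑ k, v k i j ^ 2 ≤ ∑ k, gap M₀ k ^ 2) :
    ∃ k, δ ≤ A.probQueriesGE (gaussian (Matrix.of ![w, w] + v k)) (queryBound M₀ δ) := by
  have hd : (0 : ℝ) < d := Nat.cast_pos.2 (NeZero.pos d)
  -- If `δ ≥ 1 / 6` the bound is nonpositive and the event is certain, so any shift works.
  rcases le_or_gt (queryBound M₀ δ) 0 with hx | hx
  · refine ⟨0, ?_⟩
    simp only [probQueriesGE, ENNReal.ofReal_of_nonpos hx, zero_le, Set.ofPred_true,
      probReal_univ]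
    linarith [hδ.2]
  set Q := ∑ k, gap M₀ k ^ 2 with hQ
  have hQpos : 0 < Q := by
    obtain ⟨j, hj⟩ := exists_gap_pos hM₀
    exact Finset.sum_pos' (fun _ _ => sq_nonneg _) ⟨j, Finset.mem_univ _, by positivity⟩
  have hxeq : queryBound M₀ δ = d / (2 * Q) * Real.log (1 / (6 * δ)) := by
    rw [queryBound, norm_sq_eq_sum_gap_sq]
  have hlog : 0 < Real.log (1 / (6 * δ)) := by
    rw [hxeq] at hx
    exact pos_of_mul_pos_right hx (by positivity)
  -- `T` is the largest integer strictly below the bound, so more than `T` queries means at least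
  -- the bound.
  obtain ⟨T, hT⟩ : ∃ T, ⌈queryBound M₀ δ⌉₊ = T + 1 :=
    Nat.exists_eq_succ_of_ne_zero (Nat.ceil_pos.2 hx).ne'
  have hT1 : queryBound M₀ δ ≤ T + 1 := by
    have h := Nat.le_ceil (queryBound M₀ δ)
    rw [hT] at h
    exact_mod_cast h
  have hT2 : (T : ℝ) < queryBound M₀ δ := Nat.lt_ceil.1 (by omega)
  obtain ⟨k, hk⟩ := A.exists_le_law_gaussian_add (Matrix.of ![w, w]) v (S := Q / d)
    (by positivity) (fun i j => by simpa [mul_div_cancel₀ _ hd.ne'] using hv i j)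
    (A.measurableSet_continues T) hδ.1
    (hA.law_compl_continues_le hδ.1.le hf hw hu hwu hne T) (by
      -- The left side is even at most a quarter of the logarithm, so a factor of four is to spare.
      have h1 : T * (Q / d) / 2 ≤ Real.log (1 / (6 * δ)) := by
        calc T * (Q / d) / 2 ≤ queryBound M₀ δ * (Q / d) / 2 := by gcongr
          _ = Real.log (1 / (6 * δ)) / 4 := by rw [hxeq]; field_simp; norm_num
          _ ≤ _ := by linarith
      have h6 : 0 < 6 * δ := by linarith [hδ.1]
      calc 6 * δ = Real.exp (-Real.log (1 / (6 * δ))) := by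
            rw [one_div, Real.log_inv, neg_neg, Real.exp_log h6]
        _ ≤ _ := Real.exp_le_exp.2 (neg_le_neg h1))
  refine ⟨k, ?_⟩
  refine (ENNReal.ofReal_le_iff_le_toReal (measure_ne_top _ _)).1 (hk.trans ?_)
  exact measure_mono (A.continues_subset_le_numQueries hT1)

/-- Both reference rows are the worst row of `M₀`. Unpermuted gaps added to it stay below `1`, which
gives admissible approximations; permuted gaps may exceed `1`. -/
lemma IsAccurateFor.exists_mem_sameWorstClass [NeZero d] (hA : A.IsAccurateFor f δ)
    (hδ : δ ∈ Set.Ioo (0 : ℝ) (1 / 4)) (hf : f 1 ≠ f (Equiv.swap 0 1))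
    {M₀ : Matrix (Fin 2) (Fin d) ℝ} (hM₀ : M₀ ∈ rankingMatrices 2 d) :
    ∃ ν ∈ sameWorstClass M₀, δ ≤ A.probQueriesGE ν (queryBound M₀ δ) := by
  obtain ⟨π₀, hπ₀⟩ := hM₀.1.1
  obtain ⟨k, hk⟩ := hA.exists_le_probQueriesGE hδ hf (w := M₀ (π₀ 1)) (u := gap M₀)
    (fun j => (hM₀.1.2 _ j).1) (gap_nonneg M₀)
    (fun j => by rw [gap_eq_sub M₀ hπ₀]; linarith [(hM₀.1.2 (π₀ 0) j).2])
    (exists_gap_pos hM₀) hM₀ (fun k => Matrix.of ![fun j => gap M₀ (j + k), 0]) (fun i j => by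
      rw [← sum_gap_add_sq M₀ j]
      refine Finset.sum_le_sum fun k _ => ?_
      fin_cases i
      · exact le_rfl
      · simpa using sq_nonneg (gap M₀ (j + k)))
  refine ⟨_, ⟨isSubGaussian_gaussian _, π₀, hπ₀, 1, ?_, Equiv.addRight k, fun j => ?_⟩, hk⟩
  · rw [mean_gaussian]
    exact isRanking_two_iff.2 fun j => by simpa using gap_nonneg M₀ (j + k)
  · rw [mean_gaussian]
    simp

/-- Centring at `1 / 2` and splitting each gap evenly between the experts keeps every arrangement in
`[0,1]`, since gaps are at most `1`. -/
lemma IsAccurateFor.exists_mem_boundedClass [NeZero d] (hA : A.IsAccurateFor f δ)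
    (hδ : δ ∈ Set.Ioo (0 : ℝ) (1 / 4)) (hf : f 1 ≠ f (Equiv.swap 0 1))
    {M₀ : Matrix (Fin 2) (Fin d) ℝ} (hM₀ : M₀ ∈ rankingMatrices 2 d) :
    ∃ ν ∈ boundedClass M₀, δ ≤ A.probQueriesGE ν (queryBound M₀ δ) := by
  obtain ⟨j₀, hj₀⟩ := exists_gap_pos hM₀
  have hg := gap_nonneg M₀
  have hg1 := gap_le_one hM₀
  obtain ⟨k, hk⟩ := hA.exists_le_probQueriesGE hδ hf (w := fun _ => 1 / 2)
    (u := fun j => gap M₀ j / 2) (fun _ => by norm_num) (fun j => by linarith [hg j])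
    (fun j => by linarith [hg1 j]) ⟨j₀, by linarith⟩ hM₀
    (fun k => Matrix.of ![fun j => gap M₀ (j + k) / 2, fun j => -(gap M₀ (j + k) / 2)])
    (fun i j => by
      rw [← sum_gap_add_sq M₀ j]
      refine Finset.sum_le_sum fun k _ => ?_
      fin_cases i
      · change (gap M₀ (j + k) / 2) ^ 2 ≤ _
        nlinarith [sq_nonneg (gap M₀ (j + k))]
      · change (-(gap M₀ (j + k) / 2)) ^ 2 ≤ _
        nlinarith [sq_nonneg (gap M₀ (j + k))])
  have hπ : IsRanking (Matrix.of ![fun _ : Fin d => (1 / 2 : ℝ), fun _ => 1 / 2] +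
      Matrix.of ![fun j => gap M₀ (j + k) / 2, fun j => -(gap M₀ (j + k) / 2)]) 1 :=
    isRanking_two_iff.2 fun j => by
      change (1 / 2 : ℝ) + -(gap M₀ (j + k) / 2) ≤ 1 / 2 + gap M₀ (j + k) / 2
      linarith [hg (j + k)]
  refine ⟨_, ⟨isSubGaussian_gaussian _, ?_, Equiv.addRight k, fun j => ?_⟩, hk⟩
  · rw [mean_gaussian]
    -- The cyclic shift by `k` carries the positive gap at `j₀` to task `j₀ - k`.
    refine mem_rankingMatrices_two hπ (fun i j => ?_) ⟨j₀ - k, ?_⟩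
    · have h0 := hg (j + k)
      have h1 := hg1 (j + k)
      fin_cases i
      · change 0 ≤ (1 / 2 : ℝ) + gap M₀ (j + k) / 2 ∧ (1 / 2 : ℝ) + gap M₀ (j + k) / 2 ≤ 1
        constructor <;> linarith
      · change 0 ≤ (1 / 2 : ℝ) + -(gap M₀ (j + k) / 2) ∧
          (1 / 2 : ℝ) + -(gap M₀ (j + k) / 2) ≤ 1
        constructor <;> linarith
    · change (1 / 2 : ℝ) + gap M₀ (j₀ - k + k) / 2 ≠ 1 / 2 + -(gap M₀ (j₀ - k + k) / 2)
      rw [sub_add_cancel]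
      linarith
  · rw [mean_gaussian, gap_eq_sub _ hπ]
    change (1 / 2 : ℝ) + gap M₀ (j + k) / 2 - (1 / 2 + -(gap M₀ (j + k) / 2)) = gap M₀ (j + k)
    ring

end Algorithm

theorem theorem4 (d : ℕ) (hd : 1 ≤ d) (δ : ℝ) (hδ : δ ∈ Set.Ioo (0 : ℝ) (1 / 4))
    (M₀ : Matrix (Fin 2) (Fin d) ℝ) (hM₀ : M₀ ∈ rankingMatrices 2 d) :
    (∀ A : Algorithm 2 d (Equiv.Perm (Fin 2)), A.IsAccurateForRanking δ →
      (∃ ν ∈ sameWorstClass M₀, δ ≤ A.probQueriesGE ν (queryBound M₀ δ)) ∧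
      (∃ ν ∈ boundedClass M₀, δ ≤ A.probQueriesGE ν (queryBound M₀ δ))) ∧
    (∀ A : Algorithm 2 d (Fin 2), A.IsAccurateForBestExpert δ →
      (∃ ν ∈ sameWorstClass M₀, δ ≤ A.probQueriesGE ν (queryBound M₀ δ)) ∧
      (∃ ν ∈ boundedClass M₀, δ ≤ A.probQueriesGE ν (queryBound M₀ δ))) := by
  have : NeZero d := ⟨by omega⟩
  have hswap : (1 : Equiv.Perm (Fin 2)) ≠ Equiv.swap 0 1 := by decide
  have hbest : (1 : Equiv.Perm (Fin 2)) 0 ≠ Equiv.swap 0 1 0 := by decide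
  refine ⟨fun A hA => ?_, fun A hA => ?_⟩
  · have hA' : A.IsAccurateFor id δ := hA
    exact ⟨hA'.exists_mem_sameWorstClass hδ hswap hM₀, hA'.exists_mem_boundedClass hδ hswap hM₀⟩
  · have hA' : A.IsAccurateFor (fun π => π 0) δ := fun ν hν hM =>
      hA ν hν (rankingMatrices_subset_bestExpertMatrices 2 d hM)
    exact ⟨hA'.exists_mem_sameWorstClass hδ hbest hM₀, hA'.exists_mem_boundedClass hδ hbest hM₀⟩
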